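/- Let $E$ be a (real) Banach lattice and let $M : E \to E$ be a compact linear operator that is positive, i.e. $Mx \ge 0$ whenever $x \ge 0$. Let $h \in E$ be a quasi-interior element of the positive cone, meaning that $h \ge 0$ and $\langle h, g\rangle > 0$ for every nonzero positive continuous linear functional $g$ on $E$. Then $$\lim_{n\to\infty} \|M^n h\|^{1/n} = r(M),$$ where $r(M)$ is the spectral radius of $M$, i.e. the supremum of $|\lambda|$ over all $\lambda$ in the (complex) spectrum of $M$, that is, in the spectrum of the complexification of $M$ on $E + iE$ (with $r(M)=0$ if $E=\{0\}$). -/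

import Mathlib

open Filter Topology
open scoped ENNReal NNReal

/-- The complexification `E + iE` of a real vector space `E`; the pair `⟨x, y⟩` stands for
`x + iy`. -/
@[ext]
structure Complexification (E : Type*) where
  /-- The real part. -/
  re : E
  /-- The imaginary part. -/
  im : E

namespace Complexification

section Algebra

variable {E : Type*} [AddCommGroup E]

instance : Zero (Complexification E) := ⟨⟨0, 0⟩⟩
instance : Add (Complexification E) := ⟨fun z w => ⟨z.re + w.re, z.im + w.im⟩⟩
instance : Neg (Complexification E) := ⟨fun z => ⟨-z.re, -z.im⟩⟩

@[simp] theorem zero_re : (0 : Complexification E).re = 0 := rfl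
@[simp] theorem zero_im : (0 : Complexification E).im = 0 := rfl
@[simp] theorem add_re (z w : Complexification E) : (z + w).re = z.re + w.re := rfl
@[simp] theorem add_im (z w : Complexification E) : (z + w).im = z.im + w.im := rfl
@[simp] theorem neg_re (z : Complexification E) : (-z).re = -z.re := rfl
@[simp] theorem neg_im (z : Complexification E) : (-z).im = -z.im := rfl

instance : AddCommGroup (Complexification E) where
  add_assoc a b c := by ext <;> simp [add_assoc]
  zero_add a := by ext <;> simp
  add_zero a := by ext <;> simp
  add_comm a b := by ext <;> simp [add_comm]
  neg_add_cancel a := by ext <;> simp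
  nsmul := nsmulRec
  zsmul := zsmulRec

variable [Module ℝ E]

/-- `(a + ib)(x + iy) = (ax - by) + i(ay + bx)`. -/
instance : SMul ℂ (Complexification E) :=
  ⟨fun c z => ⟨c.re • z.re - c.im • z.im, c.re • z.im + c.im • z.re⟩⟩

@[simp] theorem smul_re (c : ℂ) (z : Complexification E) :
    (c • z).re = c.re • z.re - c.im • z.im := rfl
@[simp] theorem smul_im (c : ℂ) (z : Complexification E) :
    (c • z).im = c.re • z.im + c.im • z.re := rfl

instance : Module ℂ (Complexification E) where
  one_smul z := by ext <;> simp
  mul_smul a b z := by ext <;> simp <;> module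
  smul_zero a := by ext <;> simp
  smul_add a z w := by ext <;> simp <;> module
  add_smul a b z := by ext <;> simp <;> module
  zero_smul z := by ext <;> simp

end Algebra

section Norm

variable {E : Type*} [NormedAddCommGroup E] [NormedSpace ℝ E]

/-- The norm `‖x + iy‖ = sup_θ ‖x cos θ - y sin θ‖ = sup_{|c| = 1} ‖Re (c (x + iy))‖`. -/
noncomputable instance : Norm (Complexification E) := ⟨fun z => ⨆ c : Circle, ‖((c : ℂ) • z).re‖⟩

theorem norm_def (z : Complexification E) : ‖z‖ = ⨆ c : Circle, ‖((c : ℂ) • z).re‖ := rfl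

theorem norm_smul_re_le_add (c : Circle) (z : Complexification E) :
    ‖((c : ℂ) • z).re‖ ≤ ‖z.re‖ + ‖z.im‖ := by
  have h1 : |(c : ℂ).re| ≤ 1 := (Complex.abs_re_le_norm _).trans_eq c.norm_coe
  have h2 : |(c : ℂ).im| ≤ 1 := (Complex.abs_im_le_norm _).trans_eq c.norm_coe
  rw [smul_re]
  refine (norm_sub_le _ _).trans (add_le_add ?_ ?_)
  · rw [norm_smul, Real.norm_eq_abs]
    exact mul_le_of_le_one_left (norm_nonneg _) h1
  · rw [norm_smul, Real.norm_eq_abs]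
    exact mul_le_of_le_one_left (norm_nonneg _) h2

theorem bddAbove_norm (z : Complexification E) :
    BddAbove (Set.range fun c : Circle => ‖((c : ℂ) • z).re‖) :=
  ⟨‖z.re‖ + ‖z.im‖, by rintro _ ⟨c, rfl⟩; exact norm_smul_re_le_add c z⟩

theorem norm_smul_re_le (c : Circle) (z : Complexification E) : ‖((c : ℂ) • z).re‖ ≤ ‖z‖ :=
  le_ciSup (bddAbove_norm z) c

theorem norm_re_le (z : Complexification E) : ‖z.re‖ ≤ ‖z‖ := by
  simpa using norm_smul_re_le 1 z

theorem norm_im_le (z : Complexification E) : ‖z.im‖ ≤ ‖z‖ := by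
  have h := norm_smul_re_le ⟨Complex.I, by simp [Submonoid.unitSphere]⟩ z
  simpa using h

theorem norm_smul_le_aux (a : ℂ) (z : Complexification E) : ‖a • z‖ ≤ ‖a‖ * ‖z‖ := by
  refine ciSup_le fun c => ?_
  rcases eq_or_ne a 0 with rfl | ha
  · simp
  have hn : ‖a‖ ≠ 0 := norm_ne_zero_iff.2 ha
  let d : Circle := ⟨(c : ℂ) * (a / ‖a‖), by
    have hc : ‖(c : ℂ)‖ = 1 := c.norm_coe
    simp [Submonoid.unitSphere, hn, hc]⟩
  have hd : (c : ℂ) • a • z = ((‖a‖ : ℝ) : ℂ) • (d : ℂ) • z := by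
    rw [smul_smul, smul_smul]
    congr 1
    change _ = (‖a‖ : ℂ) * ((c : ℂ) * (a / ‖a‖))
    have : (‖a‖ : ℂ) ≠ 0 := by exact_mod_cast hn
    field_simp
  rw [hd]
  have : (((‖a‖ : ℝ) : ℂ) • (d : ℂ) • z).re = ‖a‖ • ((d : ℂ) • z).re := by
    rw [smul_re]; simp
  rw [this, norm_smul, norm_norm]
  exact mul_le_mul_of_nonneg_left (norm_smul_re_le d z) (norm_nonneg _)

theorem normedSpaceCore : NormedSpace.Core ℂ (Complexification E) where
  norm_nonneg z := (norm_nonneg _).trans (norm_re_le z)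
  norm_smul a z := by
    refine le_antisymm (norm_smul_le_aux a z) ?_
    rcases eq_or_ne a 0 with rfl | ha
    · simpa using (norm_nonneg _).trans (norm_re_le ((0 : ℂ) • z))
    have h := norm_smul_le_aux a⁻¹ (a • z)
    rw [smul_smul, inv_mul_cancel₀ ha, one_smul, norm_inv] at h
    have hn : 0 < ‖a‖ := norm_pos_iff.2 ha
    calc ‖a‖ * ‖z‖ ≤ ‖a‖ * (‖a‖⁻¹ * ‖a • z‖) := mul_le_mul_of_nonneg_left h hn.le
      _ = ‖a • z‖ := by field_simp
  norm_triangle z w := by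
    refine ciSup_le fun c => ?_
    rw [smul_add, add_re]
    exact (norm_add_le _ _).trans (add_le_add (norm_smul_re_le c z) (norm_smul_re_le c w))
  norm_eq_zero_iff z := by
    constructor
    · intro h
      ext
      · simpa [h] using norm_re_le z
      · simpa [h] using norm_im_le z
    · rintro rfl
      simp [norm_def]

noncomputable instance : NormedAddCommGroup (Complexification E) :=
  NormedAddCommGroup.ofCore normedSpaceCore

noncomputable instance : NormedSpace ℂ (Complexification E) :=
  NormedSpace.ofCore normedSpaceCore

/-- The complex-linear extension `x + iy ↦ Mx + iMy` of a bounded real operator. -/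
noncomputable def mapCLM (M : E →L[ℝ] E) : Complexification E →L[ℂ] Complexification E :=
  LinearMap.mkContinuous
    { toFun := fun z => ⟨M z.re, M z.im⟩
      map_add' := fun z w => by ext <;> simp
      map_smul' := fun c z => by ext <;> simp }
    ‖M‖ fun z => by
      refine ciSup_le fun c => ?_
      have : ((c : ℂ) • (⟨M z.re, M z.im⟩ : Complexification E)).re = M ((c : ℂ) • z).re := by
        simp
      refine (le_of_eq (congrArg norm this)).trans ((M.le_opNorm _).trans ?_)
      exact mul_le_mul_of_nonneg_left (norm_smul_re_le c z) (norm_nonneg _)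

@[simp] theorem mapCLM_re (M : E →L[ℝ] E) (z : Complexification E) :
    (mapCLM M z).re = M z.re := rfl
@[simp] theorem mapCLM_im (M : E →L[ℝ] E) (z : Complexification E) :
    (mapCLM M z).im = M z.im := rfl

end Norm

end Complexification

/-- The spectral radius of a bounded operator `M` on a real normed space: the supremum of `|λ|`
over the (complex) spectrum of `M`, which, as usual, is the spectrum of its complexification. -/
noncomputable def realOperatorSpectralRadius {E : Type*} [NormedAddCommGroup E] [NormedSpace ℝ E]
    (M : E →L[ℝ] E) : ℝ≥0∞ :=
  spectralRadius ℂ (Complexification.mapCLM M)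

/-- `h` is a quasi-interior element of the positive cone: `h ≥ 0` and `⟨h, g⟩ > 0` for every
nonzero element `g` of the positive cone of the dual space. -/
def IsQuasiInterior {E : Type*} [NormedAddCommGroup E] [NormedSpace ℝ E] [PartialOrder E]
    (h : E) : Prop :=
  0 ≤ h ∧ ∀ g : StrongDual ℝ E, (∀ x, 0 ≤ x → 0 ≤ g x) → g ≠ 0 → 0 < g h

/-! The bound from above is Gelfand's formula. For the bound from below, let `r > 0` be the spectral
radius. A positive functional `g ≠ 0` with `g ∘ M = r g` gives `rⁿ g(h) = g(Mⁿ h) ≤ ‖g‖ ‖Mⁿ h‖`, and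
`g(h) > 0` because `h` is quasi-interior; now take `n`-th roots.

Such a `g` is built in `exists_positive_dual_eigenvector`. By compactness some eigenvalue `μ` has
`|μ| = r`; the moduli of the parts of its eigenvector give `u > 0` with `rⁿ u ≤ 2 Mⁿ u`. For a
positive `f` with `f(u) > 0`, the functional `φ = ∑ s⁻ⁿ f ∘ Mⁿ` satisfies `φ ∘ M = s(φ - f)`, while
`φ(u)` blows up as `s ↓ r`. So `φ / ‖φ‖` is nearly an eigenvector of the adjoint. A weak-* limit is
an exact one, and compactness of `M` keeps it from vanishing. -/

namespace Complexification

/-! ### Completeness, compactness and powers under complexification. -/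

variable {E : Type*} [NormedAddCommGroup E] [NormedSpace ℝ E]

theorem norm_le_add (z : Complexification E) : ‖z‖ ≤ ‖z.re‖ + ‖z.im‖ :=
  ciSup_le fun c => norm_smul_re_le_add c z

theorem continuous_mk :
    Continuous fun p : E × E => (⟨p.1, p.2⟩ : Complexification E) := by
  refine continuous_iff_continuousAt.2 fun p => ?_
  refine tendsto_iff_norm_sub_tendsto_zero.2 ?_
  refine squeeze_zero (g := fun q : E × E => ‖q.1 - p.1‖ + ‖q.2 - p.2‖)
    (fun q => norm_nonneg _) (fun q => ?_) ?_
  · refine (norm_le_add _).trans_eq ?_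
    simp [sub_eq_add_neg]
  · have : Continuous fun q : E × E => ‖q.1 - p.1‖ + ‖q.2 - p.2‖ := by fun_prop
    simpa using this.tendsto p

theorem continuous_re : Continuous fun z : Complexification E => z.re := by
  refine LipschitzWith.continuous (K := 1) (LipschitzWith.of_dist_le_mul fun z w => ?_)
  rw [dist_eq_norm, dist_eq_norm, NNReal.coe_one, one_mul]
  simpa [sub_eq_add_neg] using norm_re_le (z - w)

theorem continuous_im : Continuous fun z : Complexification E => z.im := by
  refine LipschitzWith.continuous (K := 1) (LipschitzWith.of_dist_le_mul fun z w => ?_)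
  rw [dist_eq_norm, dist_eq_norm, NNReal.coe_one, one_mul]
  simpa [sub_eq_add_neg] using norm_im_le (z - w)

instance [CompleteSpace E] : CompleteSpace (Complexification E) := by
  refine Metric.complete_of_cauchySeq_tendsto fun u hu => ?_
  have hre : CauchySeq fun n => (u n).re := by
    rw [Metric.cauchySeq_iff] at hu ⊢
    refine fun ε hε => (hu ε hε).imp fun N hN m hm n hn => lt_of_le_of_lt ?_ (hN m hm n hn)
    rw [dist_eq_norm, dist_eq_norm]
    simpa [sub_eq_add_neg] using norm_re_le (u m - u n)
  have him : CauchySeq fun n => (u n).im := by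
    rw [Metric.cauchySeq_iff] at hu ⊢
    refine fun ε hε => (hu ε hε).imp fun N hN m hm n hn => lt_of_le_of_lt ?_ (hN m hm n hn)
    rw [dist_eq_norm, dist_eq_norm]
    simpa [sub_eq_add_neg] using norm_im_le (u m - u n)
  obtain ⟨x, hx⟩ := cauchySeq_tendsto_of_complete hre
  obtain ⟨y, hy⟩ := cauchySeq_tendsto_of_complete him
  exact ⟨⟨x, y⟩, (continuous_mk.tendsto (x, y)).comp (hx.prodMk_nhds hy)⟩

theorem isCompactOperator_mapCLM {M : E →L[ℝ] E} (hM : IsCompactOperator M) :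
    IsCompactOperator (mapCLM M) := by
  obtain ⟨K, hK, hKM⟩ := hM
  refine ⟨_, (hK.prod hK).image continuous_mk, ?_⟩
  have h0 : Tendsto (fun z : Complexification E => z.re) (𝓝 0) (𝓝 0) := continuous_re.tendsto 0
  have h1 : Tendsto (fun z : Complexification E => z.im) (𝓝 0) (𝓝 0) := continuous_im.tendsto 0
  filter_upwards [h0 hKM, h1 hKM] with z hz hw
  exact ⟨(M z.re, M z.im), ⟨hz, hw⟩, rfl⟩

theorem mapCLM_pow_apply (M : E →L[ℝ] E) (n : ℕ) (z : Complexification E) :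
    (mapCLM M ^ n) z = ⟨(M ^ n) z.re, (M ^ n) z.im⟩ := by
  induction n with
  | zero => rfl
  | succ n ih => rw [pow_succ', pow_succ', mul_apply_eq_comp, ih]; rfl

/-- Neither `x ↦ x + i0` nor `Re` increases norms. This carries the complex Gelfand bounds over to
`M`. -/
theorem norm_pow_le_norm_mapCLM_pow (M : E →L[ℝ] E) (n : ℕ) : ‖M ^ n‖ ≤ ‖mapCLM M ^ n‖ := by
  refine ContinuousLinearMap.opNorm_le_bound _ (norm_nonneg _) fun x => ?_
  calc ‖(M ^ n) x‖ ≤ ‖(mapCLM M ^ n) ⟨x, 0⟩‖ := by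
        rw [mapCLM_pow_apply]
        exact norm_re_le (⟨(M ^ n) x, (M ^ n) 0⟩ : Complexification E)
    _ ≤ ‖mapCLM M ^ n‖ * ‖(⟨x, 0⟩ : Complexification E)‖ := ContinuousLinearMap.le_opNorm _ _
    _ ≤ ‖mapCLM M ^ n‖ * ‖x‖ := by
        refine mul_le_mul_of_nonneg_left ((norm_le_add _).trans_eq ?_) (norm_nonneg _)
        simp

end Complexification

/-! ### Roots of constants and summability from Gelfand's formula. -/

theorem ENNReal.tendsto_rpow_one_div_natCast {c : ℝ≥0∞} (h0 : c ≠ 0) (ht : c ≠ ∞) :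
    Tendsto (fun n : ℕ => c ^ (1 / (n : ℝ))) atTop (𝓝 1) := by
  lift c to ℝ≥0 using ht
  have hc : c ≠ 0 := by simpa using h0
  have : Tendsto (fun n : ℕ => c ^ (1 / (n : ℝ))) atTop (𝓝 (c ^ (0 : ℝ))) :=
    (tendsto_const_nhds.nnrpow tendsto_one_div_atTop_nhds_zero_nat (Or.inl hc))
  rw [NNReal.rpow_zero] at this
  refine (ENNReal.tendsto_coe.2 this).congr fun n => ?_
  rw [ENNReal.coe_rpow_of_ne_zero hc]

/-- If `s` exceeds the spectral radius of `a`, then `∑ ‖aⁿ‖ / sⁿ` converges. -/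
theorem spectrum.summable_norm_pow_mul_inv_pow {A : Type*} [NormedRing A] [NormedAlgebra ℂ A]
    [CompleteSpace A] {a : A} {s : ℝ≥0} (hs : spectralRadius ℂ a < s) :
    Summable fun n : ℕ => ‖a ^ n‖ * ((s : ℝ)⁻¹) ^ n := by
  -- With `t` strictly between the radius and `s`, eventually `‖aⁿ‖ ≤ tⁿ`, so `t / s < 1` is the
  -- ratio of a geometric majorant.
  obtain ⟨t, hat, hts⟩ := ENNReal.lt_iff_exists_nnreal_btwn.1 hs
  have hts : t < s := by exact_mod_cast hts
  have hs0 : (0 : ℝ) < s := by exact_mod_cast (bot_le : 0 ≤ t).trans_lt hts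
  have hlt : (t : ℝ) / s < 1 := (div_lt_one hs0).2 (by exact_mod_cast hts)
  refine (summable_geometric_of_lt_one (by positivity) hlt).of_norm_bounded_eventually_nat ?_
  filter_upwards [(spectrum.gelfand_formula a).eventually_lt_const hat, eventually_gt_atTop 0]
    with n hn hn0
  have hn' : (0 : ℝ) < n := by exact_mod_cast hn0
  have h1 : (‖a ^ n‖₊ : ℝ≥0∞) ≤ (t : ℝ≥0∞) ^ n := by
    rw [← ENNReal.rpow_natCast]
    rw [one_div] at hn
    exact (ENNReal.rpow_inv_le_iff hn').1 hn.le
  have h2 : ‖a ^ n‖ ≤ (t : ℝ) ^ n := by exact_mod_cast h1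
  rw [Real.norm_of_nonneg (by positivity), div_pow, inv_pow, div_eq_mul_inv]
  gcongr

/-! ### Positive functionals and approximate eigenvectors of the adjoint. -/

section PositiveFunctional

variable {E : Type*} [NormedAddCommGroup E] [NormedSpace ℝ E] [PartialOrder E]

/-- Approximate positive eigenvectors of the adjoint of a compact operator accumulate at a
positive eigenvector. -/
theorem exists_positive_dual_eigenvector_of_approx {M : E →L[ℝ] E} (hM : IsCompactOperator M)
    {r : ℝ} (hr : 0 < r)
    (H : ∀ ε > 0, ∃ g : StrongDual ℝ E, (∀ x, 0 ≤ x → 0 ≤ g x) ∧ ‖g‖ = 1 ∧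
      ‖g ∘L M - r • g‖ ≤ ε) :
    ∃ g : StrongDual ℝ E, (∀ x, 0 ≤ x → 0 ≤ g x) ∧ g ≠ 0 ∧ ∀ x, g (M x) = r * g x := by
  choose g hpos hnorm hg using fun k : ℕ => H (1 / ((k : ℝ) + 1)) Nat.one_div_pos_of_nat
  -- The dual ball is weak-* compact but possibly not sequentially compact; limits along an
  -- ultrafilter avoid subsequences.
  let U : Ultrafilter ℕ := hyperfilter ℕ
  have hU : (U : Filter ℕ) ≤ atTop := Nat.hyperfilter_le_atTop
  obtain ⟨g', -, hg'⟩ := (WeakDual.isCompact_closedBall (𝕜 := ℝ) (E := E) 0 1).ultrafilter_le_nhds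
    (U.map fun k => StrongDual.toWeakDual (g k)) (by
      rw [le_principal_iff]
      exact Filter.Eventually.of_forall (f := (U : Filter ℕ)) fun k => by
        simpa using (hnorm k).le)
  have hlim (x : E) : Tendsto (fun k => g k x) U (𝓝 (g' x)) :=
    ((WeakDual.eval_continuous x).tendsto g').comp hg'
  have hsmall : Tendsto (fun k => ‖g k ∘L M - r • g k‖) U (𝓝 0) :=
    squeeze_zero (fun _ => norm_nonneg _) hg
      (tendsto_one_div_add_atTop_nhds_zero_nat.mono_left hU)
  have hdiff (x : E) (k : ℕ) : |g k (M x) - r * g k x| ≤ ‖g k ∘L M - r • g k‖ * ‖x‖ :=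
    (g k ∘L M - r • g k).le_opNorm x
  refine ⟨WeakDual.toStrongDual g', fun x hx => ge_of_tendsto' (hlim x) fun k => hpos k x hx,
    ?_, fun x => ?_⟩
  -- The limit is nonzero: for almost norming `x k`, compactness gives `M (x k) → y` in norm, so `g
  -- k (M (x k)) → g' y`, while `|g k (M (x k))|` is at least `r / 2` up to an error tending to `0`.
  · have hx (k : ℕ) : ∃ x : E, ‖x‖ < 1 ∧ 1 / 2 < ‖g k x‖ :=
      (g k).exists_lt_apply_of_lt_opNorm (by rw [hnorm k]; norm_num)
    choose x hx1 hx2 using hx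
    obtain ⟨K, hK, hKM⟩ := hM.image_closedBall_subset_compact (f := (M : E →ₗ[ℝ] E)) 1
    obtain ⟨y, -, hy⟩ := hK.ultrafilter_le_nhds (U.map fun k => M (x k)) (by
      rw [le_principal_iff]
      exact Filter.Eventually.of_forall (f := (U : Filter ℕ)) fun k =>
        hKM ⟨x k, by simpa using (hx1 k).le, rfl⟩)
    have hy : Tendsto (fun k => M (x k)) U (𝓝 y) := hy
    have hgy : Tendsto (fun k => g k (M (x k))) U (𝓝 (g' y)) := by
      have h0 : Tendsto (fun k => g k (M (x k)) - g k y) U (𝓝 0) := by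
        refine squeeze_zero_norm (fun k => ?_) (tendsto_iff_norm_sub_tendsto_zero.1 hy)
        rw [← map_sub]
        simpa [hnorm k] using (g k).le_opNorm (M (x k) - y)
      simpa using h0.add (hlim y)
    have hbd : r / 2 ≤ |g' y| := by
      have h1 : Tendsto (fun k => |g k (M (x k))| + ‖g k ∘L M - r • g k‖) U (𝓝 (|g' y| + 0)) :=
        hgy.abs.add hsmall
      rw [add_zero] at h1
      refine ge_of_tendsto' h1 fun k => ?_
      have h2 := hdiff (x k) k
      have h3 : ‖g k ∘L M - r • g k‖ * ‖x k‖ ≤ ‖g k ∘L M - r • g k‖ :=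
        mul_le_of_le_one_right (norm_nonneg _) (hx1 k).le
      have h4 : r / 2 ≤ |r * g k (x k)| := by
        rw [abs_mul, abs_of_pos hr]
        have := hx2 k
        rw [Real.norm_eq_abs] at this
        nlinarith
      have h5 := abs_sub_abs_le_abs_sub (r * g k (x k)) (g k (M (x k)))
      rw [abs_sub_comm] at h5
      linarith
    intro h0
    have : g' y = 0 := congrArg (fun f : StrongDual ℝ E => f y) h0
    rw [this, abs_zero] at hbd
    linarith
  · have h1 : Tendsto (fun k => g k (M x) - r * g k x) U (𝓝 0) := by
      refine squeeze_zero_norm (hdiff x) ?_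
      simpa using hsmall.mul_const ‖x‖
    have h2 : Tendsto (fun k => g k (M x) - r * g k x) U (𝓝 (g' (M x) - r * g' x)) :=
      (hlim (M x)).sub ((hlim x).const_mul r)
    exact sub_eq_zero.1 (tendsto_nhds_unique h2 h1)

/-- The positive cone is closed and convex and misses `-u`, so Hahn–Banach separates them. -/
theorem exists_positive_dual_pos [IsOrderedAddMonoid E] [IsOrderedModule ℝ E]
    [OrderClosedTopology E] {u : E} (hu : 0 < u) :
    ∃ f : StrongDual ℝ E, (∀ x, 0 ≤ x → 0 ≤ f x) ∧ 0 < f u := by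
  have hnot : -u ∉ ProperCone.positive ℝ E := by
    rw [ProperCone.mem_positive, neg_nonneg]
    exact hu.not_ge
  obtain ⟨f, hf, hfu⟩ := (ProperCone.positive ℝ E).hyperplane_separation_point hnot
  exact ⟨f, fun x hx => hf x ((ProperCone.mem_positive ..).2 hx), by simpa using hfu⟩

theorem pow_apply_nonneg {M : E →L[ℝ] E} (hM : ∀ x, 0 ≤ x → 0 ≤ M x) (n : ℕ) {x : E}
    (hx : 0 ≤ x) : 0 ≤ (M ^ n) x := by
  induction n with
  | zero => simpa using hx
  | succ n ih => rw [pow_succ']; exact hM _ ih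

/-- If `rⁿ u ≤ 2 Mⁿ u` for all `n`, where `u > 0`, then suitable multiples of
`∑ s⁻ⁿ f ∘ Mⁿ`, as `s` decreases to `r`, are approximate eigenvectors of the adjoint of `M`. -/
theorem exists_positive_dual_approx_eigenvector [IsOrderedAddMonoid E] [IsOrderedModule ℝ E]
    [OrderClosedTopology E] {M : E →L[ℝ] E} (hpos : ∀ x, 0 ≤ x → 0 ≤ M x) {r : ℝ} (hr : 0 < r)
    (hsum : ∀ s, r < s → Summable fun n : ℕ => ‖M ^ n‖ * (s⁻¹) ^ n)
    {u : E} (hu : 0 < u) (hMu : ∀ n : ℕ, r ^ n • u ≤ (2 : ℝ) • (M ^ n) u) {ε : ℝ} (hε : 0 < ε) :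
    ∃ g : StrongDual ℝ E, (∀ x, 0 ≤ x → 0 ≤ g x) ∧ ‖g‖ = 1 ∧ ‖g ∘L M - r • g‖ ≤ ε := by
  obtain ⟨f, hf, hfu⟩ := exists_positive_dual_pos hu
  have hmono : ∀ x y, x ≤ y → f x ≤ f y := fun x y hxy => by
    have := hf _ (sub_nonneg.2 hxy)
    rwa [map_sub, sub_nonneg] at this
  -- `C` is the constant in `s ‖f‖ ≤ δ C ‖φ‖` (`hkey`), and `δ` is chosen so that the final error `δ
  -- (1 + C)` equals `ε`.
  set C : ℝ := 2 * ‖f‖ * ‖u‖ / f u with hC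
  have hC0 : 0 ≤ C := by positivity
  set δ : ℝ := ε / (1 + C) with hδ
  have hδ0 : 0 < δ := by positivity
  set s : ℝ := r + δ with hs
  have hrs : r < s := by linarith
  have hs0 : 0 < s := hr.trans hrs
  have hS : Summable fun n : ℕ => (s⁻¹) ^ n • (f ∘L (M ^ n)) := by
    refine Summable.of_norm_bounded ((hsum s hrs).mul_left ‖f‖) fun n => ?_
    rw [norm_smul, Real.norm_of_nonneg (by positivity), mul_comm, ← mul_assoc]
    exact mul_le_mul_of_nonneg_right (ContinuousLinearMap.opNorm_comp_le _ _) (by positivity)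
  let φ : StrongDual ℝ E := ∑' n : ℕ, (s⁻¹) ^ n • (f ∘L (M ^ n))
  have hval (x : E) : HasSum (fun n : ℕ => (s⁻¹) ^ n * f ((M ^ n) x)) (φ x) :=
    hS.hasSum.mapL (ContinuousLinearMap.apply ℝ ℝ x)
  have hφpos (x : E) (hx : 0 ≤ x) : 0 ≤ φ x :=
    (hval x).nonneg fun n => mul_nonneg (by positivity) (hf _ (pow_apply_nonneg hpos n hx))
  -- Composing with `M` shifts the series by one index and loses the term `n = 0`, which is `f`.
  have hφM : φ ∘L M = s • (φ - f) := by
    ext x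
    have h1 := (hasSum_nat_add_iff' 1).2 (hval x)
    have h2 := (hval (M x)).mul_left (s⁻¹)
    have h3 : s⁻¹ * φ (M x) = φ x - f x := by
      have h0 : ∑ i ∈ Finset.range 1, (s⁻¹) ^ i * f ((M ^ i) x) = f x := by simp
      rw [h0] at h1
      have h3 : (fun n : ℕ => s⁻¹ * ((s⁻¹) ^ n * f ((M ^ n) (M x)))) =
          fun n : ℕ => (s⁻¹) ^ (n + 1) * f ((M ^ (n + 1)) x) := funext fun n => by
        rw [pow_succ M n, pow_succ', mul_apply_eq_comp, mul_assoc]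
      rw [h3] at h2
      exact h2.unique h1
    change φ (M x) = s * (φ x - f x)
    rw [← h3, mul_inv_cancel_left₀ hs0.ne']
  -- The blow-up at rate `1 / δ`: the hypothesis on `u` gives `2 φ(u) ≥ ∑ (r / s)ⁿ f(u) = (s / δ)
  -- f(u)`.
  have hφu : f u * s ≤ 2 * δ * φ u := by
    have hlt : r * s⁻¹ < 1 := by rw [← div_eq_mul_inv]; exact (div_lt_one hs0).2 hrs
    have h1 := (hasSum_geometric_of_lt_one (by positivity) hlt).mul_right (f u)
    have h2 : (1 - r * s⁻¹)⁻¹ * f u ≤ 2 * φ u := by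
      refine hasSum_le (fun n => ?_) h1 ((hval u).mul_left 2)
      have h3 := hmono _ _ (hMu n)
      rw [map_smul, map_smul, smul_eq_mul, smul_eq_mul] at h3
      have h4 := mul_le_mul_of_nonneg_left h3 (by positivity : 0 ≤ (s⁻¹) ^ n)
      rw [mul_pow]
      linarith
    have h5 : (1 - r * s⁻¹)⁻¹ = s / δ := by
      have : 1 - r * s⁻¹ = δ / s := by field_simp; linarith
      rw [this, inv_div]
    rw [h5] at h2
    have h6 := mul_le_mul_of_nonneg_left h2 hδ0.le
    have h7 : δ * (s / δ * f u) = f u * s := by field_simp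
    linarith
  have hφn : φ u ≤ ‖φ‖ * ‖u‖ := (le_abs_self _).trans (φ.le_opNorm u)
  have hφu0 : 0 < φ u := by
    by_contra h
    have : 0 < f u * s := by positivity
    nlinarith
  have hφ0 : 0 < ‖φ‖ := norm_pos_iff.2 fun h => by simp [h] at hφu0
  have hkey : s * ‖f‖ ≤ δ * C * ‖φ‖ := by
    have h1 : f u * s ≤ 2 * δ * (‖φ‖ * ‖u‖) :=
      hφu.trans (mul_le_mul_of_nonneg_left hφn (by positivity))
    have h2 : δ * C * ‖φ‖ = (2 * δ * (‖φ‖ * ‖u‖)) * ‖f‖ / f u := by rw [hC]; field_simp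
    rw [h2, le_div_iff₀ hfu]
    have := mul_le_mul_of_nonneg_right h1 (norm_nonneg f)
    linarith
  refine ⟨‖φ‖⁻¹ • φ, fun x hx => mul_nonneg (by positivity) (hφpos x hx), ?_, ?_⟩
  · rw [norm_smul, norm_inv, norm_norm, inv_mul_cancel₀ hφ0.ne']
  · have h1 : (‖φ‖⁻¹ • φ) ∘L M - r • (‖φ‖⁻¹ • φ) = ‖φ‖⁻¹ • (δ • φ - s • f) := by
      rw [ContinuousLinearMap.smul_comp, hφM, hs]
      module
    rw [h1, norm_smul, norm_inv, norm_norm, inv_mul_le_iff₀ hφ0]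
    have h2 : ‖δ • φ - s • f‖ ≤ δ * ‖φ‖ + s * ‖f‖ := by
      refine (norm_sub_le _ _).trans_eq ?_
      rw [norm_smul, norm_smul, Real.norm_of_nonneg hδ0.le, Real.norm_of_nonneg hs0.le]
    have h3 : ε = δ * (1 + C) := by rw [hδ]; field_simp
    rw [h3]
    linarith

end PositiveFunctional

/-! ### Moduli in the lattice and the Krein–Rutman theorem. -/

section BanachLattice

variable {E : Type*} [NormedAddCommGroup E] [NormedSpace ℝ E] [Lattice E] [IsOrderedAddMonoid E]

theorem abs_map_le_map_abs_of_nonneg {M : E →L[ℝ] E} (hM : ∀ x, 0 ≤ x → 0 ≤ M x) (x : E) :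
    |M x| ≤ M |x| := by
  have hmono : ∀ a b, a ≤ b → M a ≤ M b := fun a b hab => by
    have := hM _ (sub_nonneg.2 hab)
    rwa [map_sub, sub_nonneg] at this
  refine abs_le'.2 ⟨hmono _ _ (le_abs_self x), ?_⟩
  rw [← map_neg]
  exact hmono _ _ (neg_le_abs x)

variable [IsOrderedModule ℝ E]

theorem abs_smul_le_of_abs_le_one {a : ℝ} (ha : |a| ≤ 1) (x : E) : |a • x| ≤ |x| := by
  have key : ∀ y : E, 0 ≤ y → ∀ b : ℝ, b ≤ 1 → b • y ≤ y := fun y hy b hb => by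
    simpa using smul_le_smul_of_nonneg_right hb hy
  have h0 : ∀ (b : ℝ), 0 ≤ b → b ≤ 1 → ∀ y : E, |b • y| ≤ |y| := fun b hb0 hb1 y => by
    refine abs_le'.2 ⟨?_, ?_⟩
    · exact (smul_le_smul_of_nonneg_left (le_abs_self y) hb0).trans (key _ (abs_nonneg y) b hb1)
    · rw [← smul_neg]
      exact (smul_le_smul_of_nonneg_left (neg_le_abs y) hb0).trans (key _ (abs_nonneg y) b hb1)
  rcases le_total 0 a with h | h
  · exact h0 a h ((le_abs_self a).trans ha) x
  · have := h0 (-a) (by linarith) ((neg_le_abs a).trans ha) x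
    rwa [neg_smul, abs_neg] at this

/-- The sum of the moduli of the real and imaginary parts of a complex vector. -/
def Complexification.absAdd (z : Complexification E) : E := |z.re| + |z.im|

namespace Complexification

/-- `absAdd` stands in for the complex modulus `sup_θ |Re (e^{iθ} z)|`: it majorizes every rotation
and needs no infinite supremum, at the price of a factor 2 below. -/
theorem abs_circle_smul_re_le (c : ℂ) (hc : ‖c‖ = 1) (z : Complexification E) :
    |(c • z).re| ≤ absAdd z := by
  rw [smul_re, sub_eq_add_neg]
  refine (abs_add_le _ _).trans (add_le_add ?_ ?_)
  · exact abs_smul_le_of_abs_le_one ((Complex.abs_re_le_norm c).trans_eq hc) _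
  · rw [abs_neg]
    exact abs_smul_le_of_abs_le_one ((Complex.abs_im_le_norm c).trans_eq hc) _

/-- An eigenvector `z` of the complexification of a positive operator gives a positive vector
`u = |Re z| + |Im z|` with `|λ|ⁿ u ≤ 2 Mⁿ u`. -/
theorem norm_pow_smul_absAdd_le {M : E →L[ℝ] E} (hM : ∀ x, 0 ≤ x → 0 ≤ M x) {μ : ℂ} (hμ : μ ≠ 0)
    {z : Complexification E} (hz : mapCLM M z = μ • z) (n : ℕ) :
    ‖μ‖ ^ n • absAdd z ≤ (2 : ℝ) • (M ^ n) (absAdd z) := by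
  have hpow : (mapCLM M ^ n) z = μ ^ n • z := by
    induction n with
    | zero => simp
    | succ n ih =>
      rw [pow_succ', mul_apply_eq_comp, ih, map_smul, hz, smul_smul, pow_succ]
  have hMn : ∀ x, 0 ≤ x → 0 ≤ (M ^ n) x := fun x hx => pow_apply_nonneg hM n hx
  have hmono : ∀ a b, a ≤ b → (M ^ n) a ≤ (M ^ n) b := fun a b hab => by
    have := hMn _ (sub_nonneg.2 hab)
    rwa [map_sub, sub_nonneg] at this
  have hμn : 0 < ‖μ‖ ^ n := pow_pos (norm_pos_iff.2 hμ) n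
  have key (d : ℂ) (hd : ‖d‖ = 1) : ‖μ‖ ^ n • |(d • z).re| ≤ (M ^ n) (absAdd z) := by
    -- The rotation cancels the phase of `μⁿ`, so that `Mⁿ Re(c z) = |μ|ⁿ Re(d z)`.
    set c : ℂ := d * ((‖μ‖ ^ n : ℝ) / μ ^ n) with hc
    have hcn : ‖c‖ = 1 := by
      rw [hc, norm_mul, hd, norm_div, norm_pow, Complex.norm_real, Real.norm_of_nonneg hμn.le,
        div_self hμn.ne', one_mul]
    have h1 : (mapCLM M ^ n) (c • z) = ((‖μ‖ ^ n : ℝ) : ℂ) • d • z := by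
      rw [map_smul, hpow, smul_smul, smul_smul]
      congr 1
      rw [hc]
      have := pow_ne_zero n hμ
      field_simp
    have h2 : (M ^ n) (c • z).re = ‖μ‖ ^ n • (d • z).re := by
      rw [mapCLM_pow_apply] at h1
      refine (congrArg Complexification.re h1).trans ?_
      rw [smul_re _ (d • z), Complex.ofReal_re, Complex.ofReal_im, zero_smul, sub_zero]
    have h3 : |‖μ‖ ^ n • (d • z).re| ≤ (M ^ n) (absAdd z) := by
      rw [← h2]
      exact (abs_map_le_map_abs_of_nonneg hMn _).trans
        (hmono _ _ (abs_circle_smul_re_le c hcn z))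
    calc ‖μ‖ ^ n • |(d • z).re| = ‖μ‖ ^ n • |(‖μ‖ ^ n)⁻¹ • (‖μ‖ ^ n • (d • z).re)| := by
          rw [smul_smul, inv_mul_cancel₀ hμn.ne', one_smul]
      _ ≤ ‖μ‖ ^ n • (‖μ‖ ^ n)⁻¹ • |‖μ‖ ^ n • (d • z).re| := by
          refine smul_le_smul_of_nonneg_left (abs_le'.2 ⟨?_, ?_⟩) hμn.le
          · exact smul_le_smul_of_nonneg_left (le_abs_self _) (by positivity)
          · rw [← smul_neg]
            exact smul_le_smul_of_nonneg_left (neg_le_abs _) (by positivity)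
      _ = |‖μ‖ ^ n • (d • z).re| := by rw [smul_smul, mul_inv_cancel₀ hμn.ne', one_smul]
      _ ≤ _ := h3
  -- `d = 1` controls `|Re z|` and `d = i` controls `|Im z|`; adding the two produces the factor 2.
  have hre := key 1 (by simp)
  have him := key Complex.I (by simp)
  have e2 : (Complex.I • z).re = -z.im := by simp
  rw [one_smul] at hre
  rw [e2, abs_neg] at him
  rw [two_smul]
  conv_lhs => rw [absAdd, smul_add]
  exact add_le_add hre him

theorem absAdd_pos {z : Complexification E} (hz : z ≠ 0) : 0 < absAdd z := by
  refine lt_of_le_of_ne (add_nonneg (abs_nonneg _) (abs_nonneg _)) fun h => hz ?_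
  have h := (add_eq_zero_iff_of_nonneg (abs_nonneg z.re) (abs_nonneg z.im)).1 h.symm
  have key : ∀ x : E, |x| = 0 → x = 0 := fun x hx =>
    le_antisymm ((le_abs_self x).trans_eq hx) (neg_nonpos.1 ((neg_le_abs x).trans_eq hx))
  exact Complexification.ext (key _ h.1) (key _ h.2)

end Complexification

variable [CompleteSpace E] [HasSolidNorm E]

/-- **Krein–Rutman theorem** for the adjoint of a compact positive operator. -/
theorem exists_positive_dual_eigenvector {M : E →L[ℝ] E} (hMpos : ∀ x : E, 0 ≤ x → 0 ≤ M x)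
    (hMcpt : IsCompactOperator M) (hr : realOperatorSpectralRadius M ≠ 0) :
    ∃ r : ℝ≥0, realOperatorSpectralRadius M = r ∧ ∃ g : StrongDual ℝ E,
      (∀ x, 0 ≤ x → 0 ≤ g x) ∧ g ≠ 0 ∧ ∀ x, g (M x) = r * g x := by
  -- An empty spectrum, as for `E = {0}`, has radius `0` (an empty supremum), which `hr` excludes.
  have hne : (spectrum ℂ (Complexification.mapCLM M)).Nonempty := by
    by_contra h
    rw [Set.not_nonempty_iff_eq_empty] at h
    exact hr (by simp [realOperatorSpectralRadius, spectralRadius, h])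
  obtain ⟨μ, hμ, hμr⟩ := spectrum.exists_nnnorm_eq_spectralRadius_of_nonempty hne
  have hμr : realOperatorSpectralRadius M = ‖μ‖₊ := hμr.symm
  have hμ0 : μ ≠ 0 := by
    rintro rfl
    exact hr (by simpa using hμr)
  have hμp : 0 < ‖μ‖ := norm_pos_iff.2 hμ0
  obtain ⟨z, hz⟩ := (((Complexification.isCompactOperator_mapCLM hMcpt).hasEigenvalue_iff_mem_spectrum
    hμ0).2 hμ).exists_hasEigenvector
  refine ⟨‖μ‖₊, hμr, ?_⟩
  refine exists_positive_dual_eigenvector_of_approx hMcpt hμp fun ε hε =>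
    exists_positive_dual_approx_eigenvector hMpos hμp (fun s hs => ?_)
      (Complexification.absAdd_pos hz.2)
      (Complexification.norm_pow_smul_absAdd_le hMpos hμ0 hz.apply_eq_smul) hε
  lift s to ℝ≥0 using hμp.le.trans hs.le
  have hlt : spectralRadius ℂ (Complexification.mapCLM M) < s := by
    have : realOperatorSpectralRadius M < s := by rw [hμr]; exact_mod_cast hs
    exact this
  refine (spectrum.summable_norm_pow_mul_inv_pow hlt).of_nonneg_of_le (fun n => by positivity)
    fun n => ?_
  exact mul_le_mul_of_nonneg_right (Complexification.norm_pow_le_norm_mapCLM_pow M n)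
    (by positivity)

end BanachLattice

/-! ### The limit formula. -/

theorem mainTheorem3 {E : Type*} [NormedAddCommGroup E] [NormedSpace ℝ E] [CompleteSpace E]
    [Lattice E] [IsOrderedAddMonoid E] [IsOrderedModule ℝ E] [HasSolidNorm E]
    (M : E →L[ℝ] E) (hMpos : ∀ x : E, 0 ≤ x → 0 ≤ M x) (hMcpt : IsCompactOperator M)
    (h : E) (hh : IsQuasiInterior h) :
    Tendsto (fun n : ℕ => (‖(M ^ n) h‖₊ : ℝ≥0∞) ^ (1 / (n : ℝ))) atTop
      (𝓝 (realOperatorSpectralRadius M)) := by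
  -- `‖h‖ + 1` replaces `‖h‖` so that the roots of the constant tend to `1` even when `h = 0`.
  have hgelf : Tendsto (fun n : ℕ => (‖Complexification.mapCLM M ^ n‖₊ : ℝ≥0∞) ^ (1 / (n : ℝ)) *
      ((‖h‖₊ + 1 : ℝ≥0) : ℝ≥0∞) ^ (1 / (n : ℝ))) atTop (𝓝 (realOperatorSpectralRadius M)) := by
    have := ENNReal.Tendsto.mul (spectrum.gelfand_formula (Complexification.mapCLM M))
      (Or.inr ENNReal.one_ne_top)
      (ENNReal.tendsto_rpow_one_div_natCast (c := ((‖h‖₊ + 1 : ℝ≥0) : ℝ≥0∞))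
        (ENNReal.coe_ne_zero.2 (by positivity)) ENNReal.coe_ne_top)
      (Or.inl one_ne_zero)
    rwa [mul_one] at this
  have hupper (n : ℕ) : (‖(M ^ n) h‖₊ : ℝ≥0∞) ^ (1 / (n : ℝ)) ≤
      (‖Complexification.mapCLM M ^ n‖₊ : ℝ≥0∞) ^ (1 / (n : ℝ)) *
        ((‖h‖₊ + 1 : ℝ≥0) : ℝ≥0∞) ^ (1 / (n : ℝ)) := by
    rw [← ENNReal.mul_rpow_of_nonneg _ _ (by positivity)]
    refine ENNReal.rpow_le_rpow ?_ (by positivity)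
    have h1 : ‖(M ^ n) h‖₊ ≤ ‖Complexification.mapCLM M ^ n‖₊ * (‖h‖₊ + 1) :=
      ((M ^ n).le_opNNNorm h).trans
        (mul_le_mul' (Complexification.norm_pow_le_norm_mapCLM_pow M n) (le_add_of_nonneg_right
          zero_le_one))
    exact_mod_cast h1
  rcases eq_or_ne (realOperatorSpectralRadius M) 0 with hr | hr
  · rw [hr] at hgelf ⊢
    exact tendsto_of_tendsto_of_tendsto_of_le_of_le tendsto_const_nhds hgelf
      (fun _ => bot_le) hupper
  obtain ⟨r, hMr, g, hgpos, hg0, hgM⟩ := exists_positive_dual_eigenvector hMpos hMcpt hr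
  have hgh : 0 < g h := hh.2 g hgpos hg0
  have hgn : 0 < ‖g‖ := norm_pos_iff.2 hg0
  have hgMn (n : ℕ) : g ((M ^ n) h) = r ^ n * g h := by
    induction n with
    | zero => simp
    | succ n ih => rw [pow_succ', mul_apply_eq_comp, hgM, ih]; ring
  -- From `rⁿ g(h) = g(Mⁿ h) ≤ ‖g‖ ‖Mⁿ h‖`.
  set c : ℝ≥0 := ⟨g h / ‖g‖, by positivity⟩
  have hc0 : c ≠ 0 := fun h0 => (div_pos hgh hgn).ne' (congrArg NNReal.toReal h0)
  have hlow : Tendsto (fun n : ℕ => (r : ℝ≥0∞) * (c : ℝ≥0∞) ^ (1 / (n : ℝ))) atTop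
      (𝓝 (realOperatorSpectralRadius M)) := by
    rw [hMr]
    have := ENNReal.Tendsto.const_mul (a := (r : ℝ≥0∞)) (ENNReal.tendsto_rpow_one_div_natCast
      (ENNReal.coe_ne_zero.2 hc0) ENNReal.coe_ne_top) (Or.inl one_ne_zero)
    rwa [mul_one] at this
  refine tendsto_of_tendsto_of_tendsto_of_le_of_le' hlow hgelf ?_ (Eventually.of_forall hupper)
  -- At `n = 0` the exponent `1 / 0` is `0`, and the bound would read `r ≤ 1`.
  filter_upwards [eventually_gt_atTop 0] with n hn
  have hn' : (n : ℝ) ≠ 0 := by exact_mod_cast hn.ne'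
  have h1 : r ^ n * c ≤ ‖(M ^ n) h‖₊ := by
    rw [← NNReal.coe_le_coe]
    change (r : ℝ) ^ n * (g h / ‖g‖) ≤ ‖(M ^ n) h‖
    rw [← mul_div_assoc, ← hgMn, div_le_iff₀ hgn, mul_comm]
    exact (le_abs_self _).trans (g.le_opNorm _)
  calc (r : ℝ≥0∞) * (c : ℝ≥0∞) ^ (1 / (n : ℝ))
      = ((r : ℝ≥0∞) ^ n * c) ^ (1 / (n : ℝ)) := by
        rw [ENNReal.mul_rpow_of_nonneg _ _ (by positivity), ← ENNReal.rpow_natCast,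
          ← ENNReal.rpow_mul, mul_one_div_cancel hn', ENNReal.rpow_one]
    _ ≤ _ := ENNReal.rpow_le_rpow (by exact_mod_cast h1) (by positivity)
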